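/- Let $\gamma_n$ denote the standard Gaussian measure on $\mathbb{R}^n$. There exist numerical constants $C, C' > 0$ (independent of $n$, of $f$ and of the probability space) such that the following hold for every $n \ge 1$. (1) For every continuously differentiable $f : \mathbb{R}^n \to \mathbb{R}$, $$\mathrm{Var}_{\gamma_n}(f) \le C \sum_{i=1}^n \int_{\mathbb{R}^n} (\partial_i f(x))^2 \left(\frac{1}{1+|x_i|}\right)^2 d\gamma_n(x),$$ as an inequality in $[0,+\infty]$, where $\mathrm{Var}_{\gamma_n}(f)=+\infty$ if $f \notin L^2(\gamma_n)$; in particular, $f\in L^2(\gamma_n)$ whenever the right-hand side is finite. (2) If $X_1,\dots,X_n$ are independent standard Gaussian random variables on a probability space and $M_n = \max_{1\le i\le n} X_i$, then $M_n$ is square integrable and $$\mathrm{Var}(M_n) \le C\, \mathbb{E}\left[\frac{1}{1+M_n^2}\right] \le \frac{C'}{1+\log n}.$$ -/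

import Mathlib

open MeasureTheory ProbabilityTheory
open scoped ENNReal

/-- The standard Gaussian measure on `ℝⁿ`: the `n`-fold product of the law `N(0,1)`. -/
noncomputable def stdGaussianPi (n : ℕ) : Measure (Fin n → ℝ) :=
  Measure.pi (fun _ => gaussianReal 0 1)

/-- The `i`-th partial derivative of `f` at `x`. -/
noncomputable def partialDeriv {n : ℕ} (f : (Fin n → ℝ) → ℝ) (i : Fin n) (x : Fin n → ℝ) : ℝ :=
  fderiv ℝ f x (Pi.single i 1)

/-- The pointwise maximum of `X 0, …, X (n-1)`; for `n ≥ 1` the supremum is over a nonempty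
finite family, hence is a maximum. -/
noncomputable def maxOf {Ω : Type*} {n : ℕ} (X : Fin n → Ω → ℝ) (ω : Ω) : ℝ :=
  ⨆ i, X i ω

/-! The weighted Poincaré inequality is one-dimensional: variance is subadditive over products, so a
bound on each coordinate line gives one in dimension n with the same constant. Variance is replaced
by `doubleVar`, which makes sense for any measurable function, so no integrability has to be
assumed; square integrability follows from finiteness of the bound.

On the line, center `f` at `f 0` and treat each half-line by a weighted Hardy inequality
(`hardy_gaussian_half_line`): Cauchy–Schwarz with a well-chosen weight, then Tonelli and a Gaussian
tail bound, which produces the gain `1 / (1 + t) ^ 2`. `doubleVar_pi_le` tensorizes this.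

The maximum is not C¹, so derivatives are replaced by upper gradients along coordinate lines. The
gradient of the maximum in direction i is the indicator that coordinate i is the strict maximum.
These events are disjoint, so the sum of weights collapses to at most `1 / (1 + M ^ 2)`. The
logarithmic bound holds because M is rarely below `√(log n / 2)`. -/

/-! ### Variance as a double integral. -/

/-- The double integral `∬ |f x - f y|² dμ(x) dμ(y)`, with values in `[0, ∞]`. For a probability
measure it is twice the variance of `f`. -/
noncomputable def doubleVar {α : Type*} [MeasurableSpace α] (μ : Measure α) (f : α → ℝ) : ℝ≥0∞ :=
  ∫⁻ x, ∫⁻ y, ‖f x - f y‖ₑ ^ 2 ∂μ ∂μ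

theorem evariance_le_lintegral_sub_const {α : Type*} [MeasurableSpace α] {μ : Measure α}
    [IsProbabilityMeasure μ] {f : α → ℝ} (hf : AEStronglyMeasurable f μ) (c : ℝ) :
    evariance f μ ≤ ∫⁻ x, ‖f x - c‖ₑ ^ 2 ∂μ := by
  have hfc : AEStronglyMeasurable (fun x => f x - c) μ := hf.sub aestronglyMeasurable_const
  have key : evariance (fun x => f x - c) μ ≤ ∫⁻ x, ‖f x - c‖ₑ ^ 2 ∂μ := by
    rw [evariance_def' hfc]
    exact tsub_le_self
  refine le_trans (le_of_eq ?_) key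
  -- Translation invariance of `evariance`: outside L² both sides are infinite, so the junk value of
  -- the mean does no harm.
  by_cases h : MemLp f 2 μ
  · have hi : Integrable f μ := h.integrable one_le_two
    simp only [evariance]
    rw [integral_sub hi (integrable_const c)]
    simp
  · rw [evariance_eq_top hf h, evariance_eq_top hfc]
    intro h'
    apply h
    have := h'.add (memLp_const c)
    refine this.congr_norm hf ?_
    simp

/-- Some `x` has inner integral at most the average over `x`; take `f x` as the center. The lost
factor 2 is harmless. -/
theorem evariance_le_doubleVar {α : Type*} [MeasurableSpace α] {μ : Measure α}
    [IsProbabilityMeasure μ] {f : α → ℝ} (hf : Measurable f) :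
    evariance f μ ≤ doubleVar μ f := by
  have hm : AEMeasurable (fun x => ∫⁻ y, ‖f x - f y‖ₑ ^ 2 ∂μ) μ := by
    apply Measurable.aemeasurable
    apply Measurable.lintegral_prod_right' (f := fun p : α × α => ‖f p.1 - f p.2‖ₑ ^ 2)
    fun_prop
  obtain ⟨x, hx⟩ := exists_le_lintegral hm
  refine (evariance_le_lintegral_sub_const hf.aestronglyMeasurable (f x)).trans (le_trans ?_ hx)
  refine le_of_eq (lintegral_congr fun y => ?_)
  rw [← enorm_neg, neg_sub]

theorem doubleVar_le_lintegral_sub_const {α : Type*} [MeasurableSpace α] {μ : Measure α}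
    [IsProbabilityMeasure μ] {f : α → ℝ} (hf : Measurable f) (c : ℝ) :
    doubleVar μ f ≤ 4 * ∫⁻ x, ‖f x - c‖ₑ ^ 2 ∂μ := by
  have h1 : ∀ x y, ‖f x - f y‖ₑ ^ 2 ≤ 2 * ‖f x - c‖ₑ ^ 2 + 2 * ‖f y - c‖ₑ ^ 2 := by
    intro x y
    have e : ∀ r : ℝ, ‖r‖ₑ ^ 2 = ENNReal.ofReal (r ^ 2) := fun r => by
      rw [← enorm_pow, Real.enorm_of_nonneg (sq_nonneg _)]
    have e2 : (2 : ℝ≥0∞) = ENNReal.ofReal 2 := by simp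
    rw [e, e, e, e2, ← ENNReal.ofReal_mul zero_le_two, ← ENNReal.ofReal_mul zero_le_two,
      ← ENNReal.ofReal_add (by positivity) (by positivity)]
    apply ENNReal.ofReal_le_ofReal
    nlinarith [sq_nonneg (f x - c + (f y - c))]
  calc doubleVar μ f
      ≤ ∫⁻ x, ∫⁻ y, (2 * ‖f x - c‖ₑ ^ 2 + 2 * ‖f y - c‖ₑ ^ 2) ∂μ ∂μ :=
        lintegral_mono fun x => lintegral_mono fun y => h1 x y
    _ = 4 * ∫⁻ x, ‖f x - c‖ₑ ^ 2 ∂μ := by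
        have hm : Measurable fun x => ‖f x - c‖ₑ ^ 2 := by fun_prop
        have : ∀ x, ∫⁻ y, (2 * ‖f x - c‖ₑ ^ 2 + 2 * ‖f y - c‖ₑ ^ 2) ∂μ
            = 2 * ‖f x - c‖ₑ ^ 2 + 2 * ∫⁻ y, ‖f y - c‖ₑ ^ 2 ∂μ := by
          intro x
          rw [lintegral_add_left measurable_const, lintegral_const_mul _ hm]
          simp
        simp_rw [this]
        rw [lintegral_add_left (hm.const_mul 2), lintegral_const_mul _ hm]
        simp only [lintegral_const, measure_univ, mul_one]
        rw [← add_mul]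
        norm_num

theorem MeasureTheory.MeasurePreserving.doubleVar_comp {α β : Type*} [MeasurableSpace α]
    [MeasurableSpace β] {μ : Measure α} {ν : Measure β} [SFinite ν] {e : α → β}
    (he : MeasurePreserving e μ ν) {f : β → ℝ} (hf : Measurable f) :
    doubleVar μ (f ∘ e) = doubleVar ν f := by
  have hm : Measurable (fun x => ∫⁻ y, ‖f x - f y‖ₑ ^ 2 ∂ν) := by
    apply Measurable.lintegral_prod_right' (f := fun p : β × β => ‖f p.1 - f p.2‖ₑ ^ 2)
    fun_prop
  unfold doubleVar
  rw [← he.lintegral_comp hm]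
  refine lintegral_congr fun x => ?_
  rw [← he.lintegral_comp (f := fun y => ‖f (e x) - f y‖ₑ ^ 2) (by fun_prop)]
  rfl

/-! ### Tensorization. -/

/-- The difference of the two sides is `(a - b - c + d) ^ 2`. With the values of `f` at the corners
of a rectangle, the diagonals give the joint variance and the sides the partial ones. -/
theorem enorm_sq_quadrilateral (a b c d : ℝ) :
    ‖a - d‖ₑ ^ 2 + ‖b - c‖ₑ ^ 2 ≤
      (‖a - b‖ₑ ^ 2 + ‖c - d‖ₑ ^ 2) + (‖a - c‖ₑ ^ 2 + ‖b - d‖ₑ ^ 2) := by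
  have e : ∀ r : ℝ, ‖r‖ₑ ^ 2 = ENNReal.ofReal (r ^ 2) := fun r => by
    rw [← enorm_pow, Real.enorm_of_nonneg (sq_nonneg _)]
  simp only [e]
  simp only [← ENNReal.ofReal_add, sq_nonneg, add_nonneg]
  apply ENNReal.ofReal_le_ofReal
  nlinarith [sq_nonneg (a - b - c + d)]

/-- Subadditivity of the variance over a product of two probability spaces. -/
theorem doubleVar_prod_le {α β : Type*} [MeasurableSpace α] [MeasurableSpace β]
    {μ : Measure α} {ν : Measure β} [IsProbabilityMeasure μ] [IsProbabilityMeasure ν]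
    {f : α × β → ℝ} (hf : Measurable f) :
    doubleVar (μ.prod ν) f ≤
      ∫⁻ y, doubleVar μ (fun x => f (x, y)) ∂ν + ∫⁻ x, doubleVar ν (fun y => f (x, y)) ∂μ := by
  have h4 : ∀ F : α → β → α → β → ℝ≥0∞,
      Measurable (fun p : ((α × β) × α) × β => F p.1.1.1 p.1.1.2 p.1.2 p.2) →
      ∫⁻ p, F p.1.1.1 p.1.1.2 p.1.2 p.2 ∂(((μ.prod ν).prod μ).prod ν) =
        ∫⁻ x, ∫⁻ y, ∫⁻ x', ∫⁻ y', F x y x' y' ∂ν ∂μ ∂ν ∂μ := by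
    intro F hF
    rw [lintegral_prod _ hF.aemeasurable,
      lintegral_prod _ (Measurable.lintegral_prod_right' hF).aemeasurable,
      lintegral_prod _ (Measurable.lintegral_prod_right'
        (Measurable.lintegral_prod_right' hF)).aemeasurable]
  set π := ((μ.prod ν).prod μ).prod ν with hπ
  have m1 : Measurable fun p : ((α × β) × α) × β =>
      ‖f (p.1.1.1, p.1.1.2) - f (p.1.2, p.2)‖ₑ ^ 2 := by fun_prop
  have m2 : Measurable fun p : ((α × β) × α) × β =>
      ‖f (p.1.1.1, p.2) - f (p.1.2, p.1.1.2)‖ₑ ^ 2 := by fun_prop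
  have m3 : Measurable fun p : ((α × β) × α) × β =>
      ‖f (p.1.1.1, p.1.1.2) - f (p.1.1.1, p.2)‖ₑ ^ 2 := by fun_prop
  have m4 : Measurable fun p : ((α × β) × α) × β =>
      ‖f (p.1.2, p.1.1.2) - f (p.1.2, p.2)‖ₑ ^ 2 := by fun_prop
  have m5 : Measurable fun p : ((α × β) × α) × β =>
      ‖f (p.1.1.1, p.1.1.2) - f (p.1.2, p.1.1.2)‖ₑ ^ 2 := by fun_prop
  have m6 : Measurable fun p : ((α × β) × α) × β =>
      ‖f (p.1.1.1, p.2) - f (p.1.2, p.2)‖ₑ ^ 2 := by fun_prop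
  have swapm : ∀ (F : α → β → ℝ≥0∞), Measurable (fun p : α × β => F p.1 p.2) →
      ∫⁻ x, ∫⁻ y, F x y ∂ν ∂μ = ∫⁻ y, ∫⁻ x, F x y ∂μ ∂ν := fun F hF =>
    lintegral_lintegral_swap hF.aemeasurable
  have hD : doubleVar (μ.prod ν) f
      = ∫⁻ x, ∫⁻ y, ∫⁻ x', ∫⁻ y', ‖f (x, y) - f (x', y')‖ₑ ^ 2 ∂ν ∂μ ∂ν ∂μ := by
    unfold doubleVar
    rw [lintegral_prod _ (Measurable.aemeasurable (Measurable.lintegral_prod_right'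
      (f := fun p : (α × β) × (α × β) => ‖f p.1 - f p.2‖ₑ ^ 2) (by fun_prop)))]
    refine lintegral_congr fun x => lintegral_congr fun y => ?_
    rw [lintegral_prod _ (by fun_prop)]
  have e1 := h4 (fun x y x' y' => ‖f (x, y) - f (x', y')‖ₑ ^ 2) m1
  -- The other diagonal has the same integral, by exchanging the roles of `y` and `y'`.
  have e2 : ∫⁻ p, ‖f (p.1.1.1, p.2) - f (p.1.2, p.1.1.2)‖ₑ ^ 2 ∂π = doubleVar (μ.prod ν) f := by
    rw [h4 (fun x y x' y' => ‖f (x, y') - f (x', y)‖ₑ ^ 2) m2, hD]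
    refine lintegral_congr fun x => ?_
    have : ∀ y, ∫⁻ x', ∫⁻ y', ‖f (x, y') - f (x', y)‖ₑ ^ 2 ∂ν ∂μ
        = ∫⁻ y', ∫⁻ x', ‖f (x, y') - f (x', y)‖ₑ ^ 2 ∂μ ∂ν := fun y =>
      swapm _ (by fun_prop)
    simp_rw [this]
    rw [lintegral_lintegral_swap]
    · refine lintegral_congr fun y => ?_
      rw [swapm (fun x' y' => ‖f (x, y) - f (x', y')‖ₑ ^ 2) (by fun_prop)]
    · apply Measurable.aemeasurable
      apply Measurable.lintegral_prod_right'
        (f := fun p : (β × β) × α => ‖f (x, p.1.2) - f (p.2, p.1.1)‖ₑ ^ 2)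
      fun_prop
  have hB : ∫⁻ x, doubleVar ν (fun y => f (x, y)) ∂μ
      = ∫⁻ x, ∫⁻ y, ∫⁻ y', ‖f (x, y) - f (x, y')‖ₑ ^ 2 ∂ν ∂ν ∂μ := rfl
  have hA : ∫⁻ y, doubleVar μ (fun x => f (x, y)) ∂ν
      = ∫⁻ y, ∫⁻ x, ∫⁻ x', ‖f (x, y) - f (x', y)‖ₑ ^ 2 ∂μ ∂μ ∂ν := rfl
  have e3 : ∫⁻ p, ‖f (p.1.1.1, p.1.1.2) - f (p.1.1.1, p.2)‖ₑ ^ 2 ∂π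
      = ∫⁻ x, doubleVar ν (fun y => f (x, y)) ∂μ := by
    rw [h4 (fun x y x' y' => ‖f (x, y) - f (x, y')‖ₑ ^ 2) m3, hB]
    simp
  have e4 : ∫⁻ p, ‖f (p.1.2, p.1.1.2) - f (p.1.2, p.2)‖ₑ ^ 2 ∂π
      = ∫⁻ x, doubleVar ν (fun y => f (x, y)) ∂μ := by
    rw [h4 (fun x y x' y' => ‖f (x', y) - f (x', y')‖ₑ ^ 2) m4, hB]
    simp only [lintegral_const, measure_univ, mul_one]
    rw [lintegral_lintegral_swap]
    apply Measurable.aemeasurable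
    apply Measurable.lintegral_prod_right'
      (f := fun p : (β × α) × β => ‖f (p.1.2, p.1.1) - f (p.1.2, p.2)‖ₑ ^ 2)
    fun_prop
  have e5 : ∫⁻ p, ‖f (p.1.1.1, p.1.1.2) - f (p.1.2, p.1.1.2)‖ₑ ^ 2 ∂π
      = ∫⁻ y, doubleVar μ (fun x => f (x, y)) ∂ν := by
    rw [h4 (fun x y x' y' => ‖f (x, y) - f (x', y)‖ₑ ^ 2) m5, hA]
    simp only [lintegral_const, measure_univ, mul_one]
    rw [lintegral_lintegral_swap]
    apply Measurable.aemeasurable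
    apply Measurable.lintegral_prod_right'
      (f := fun p : (α × β) × α => ‖f (p.1.1, p.1.2) - f (p.2, p.1.2)‖ₑ ^ 2)
    fun_prop
  have e6 : ∫⁻ p, ‖f (p.1.1.1, p.2) - f (p.1.2, p.2)‖ₑ ^ 2 ∂π
      = ∫⁻ y, doubleVar μ (fun x => f (x, y)) ∂ν := by
    rw [h4 (fun x y x' y' => ‖f (x, y') - f (x', y')‖ₑ ^ 2) m6, hA]
    simp only [lintegral_const, measure_univ, mul_one]
    have : ∀ x, ∫⁻ x', ∫⁻ y', ‖f (x, y') - f (x', y')‖ₑ ^ 2 ∂ν ∂μ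
        = ∫⁻ y', ∫⁻ x', ‖f (x, y') - f (x', y')‖ₑ ^ 2 ∂μ ∂ν := fun x => swapm _ (by fun_prop)
    simp_rw [this]
    rw [lintegral_lintegral_swap]
    apply Measurable.aemeasurable
    apply Measurable.lintegral_prod_right'
      (f := fun p : (α × β) × α => ‖f (p.1.1, p.1.2) - f (p.2, p.1.2)‖ₑ ^ 2)
    fun_prop
  have m34 : Measurable fun p : ((α × β) × α) × β =>
      ‖f (p.1.1.1, p.1.1.2) - f (p.1.1.1, p.2)‖ₑ ^ 2 + ‖f (p.1.2, p.1.1.2) - f (p.1.2, p.2)‖ₑ ^ 2 :=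
    m3.add m4
  have key := lintegral_mono (μ := π) fun p : ((α × β) × α) × β =>
    enorm_sq_quadrilateral (f (p.1.1.1, p.1.1.2)) (f (p.1.1.1, p.2)) (f (p.1.2, p.1.1.2))
      (f (p.1.2, p.2))
  rw [lintegral_add_left m1, lintegral_add_left m34, lintegral_add_left m3,
    lintegral_add_left m5, e1, ← hD, e2, e3, e4, e5, e6] at key
  -- Each quantity occurs twice, so the factor 2 cancels, even when the values are infinite.
  rw [← two_mul, ← two_mul, ← two_mul, ← mul_add, add_comm] at key
  exact (ENNReal.mul_le_mul_iff_right two_ne_zero ENNReal.ofNat_ne_top).1 key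

/-- `g` dominates the increments of `f` on intervals: `|f t - f s| ≤ ∫_s^t g`. -/
def IsUpperGradient (f : ℝ → ℝ) (g : ℝ → ℝ≥0∞) : Prop :=
  ∀ s t, s ≤ t → ‖f t - f s‖ₑ ≤ ∫⁻ u in Set.Ioc s t, g u

/-- A one-dimensional weighted Poincaré inequality tensorizes. -/
theorem doubleVar_pi_le {μ : Measure ℝ} [IsProbabilityMeasure μ] {w : ℝ → ℝ≥0∞}
    (hw : Measurable w)
    (hP : ∀ (f : ℝ → ℝ) (g : ℝ → ℝ≥0∞), Measurable f → Measurable g → IsUpperGradient f g →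
      doubleVar μ f ≤ ∫⁻ t, g t ^ 2 * w t ∂μ) (n : ℕ) :
    ∀ (F : (Fin n → ℝ) → ℝ) (G : Fin n → (Fin n → ℝ) → ℝ≥0∞), Measurable F →
      (∀ i, Measurable (G i)) →
      (∀ i x, IsUpperGradient (fun u => F (Function.update x i u))
        (fun u => G i (Function.update x i u))) →
      doubleVar (Measure.pi fun _ : Fin n => μ) F ≤
        ∑ i, ∫⁻ x, G i x ^ 2 * w (x i) ∂(Measure.pi fun _ : Fin n => μ) := by
  induction n with
  | zero =>
    intro F G _ _ _
    have : ∀ x y : Fin 0 → ℝ, F x - F y = 0 := fun x y => by rw [Subsingleton.elim x y, sub_self]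
    simp [doubleVar, this]
  | succ n ih =>
    intro F G hF hG h
    have he := (measurePreserving_piFinSuccAbove (fun _ : Fin (n + 1) => μ) 0).symm
    set e := (MeasurableEquiv.piFinSuccAbove (fun _ : Fin (n + 1) => ℝ) 0).symm with hedef
    have hecons : ∀ t y, e (t, y) = (Fin.cons t y : Fin (n + 1) → ℝ) := by
      intro t y
      simp [hedef, MeasurableEquiv.piFinSuccAbove, Fin.insertNthEquiv]
    have hmc : Measurable fun p : ℝ × (Fin n → ℝ) => (Fin.cons p.1 p.2 : Fin (n + 1) → ℝ) := by
      simpa only [← hecons] using e.measurable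
    have hL : ∀ K : (Fin (n + 1) → ℝ) → ℝ≥0∞, Measurable K →
        ∫⁻ x, K x ∂(Measure.pi fun _ : Fin (n + 1) => μ) =
          ∫⁻ t, ∫⁻ y, K (Fin.cons t y) ∂(Measure.pi fun _ : Fin n => μ) ∂μ := by
      intro K hK
      rw [← he.lintegral_comp hK,
        lintegral_prod (fun p => K (e p)) (hK.comp e.measurable).aemeasurable]
      simp_rw [hecons]
    rw [← he.doubleVar_comp hF]
    refine (doubleVar_prod_le (hF.comp e.measurable)).trans ?_
    simp only [Function.comp_apply, hecons]
    rw [Fin.sum_univ_succ]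
    have hm : ∀ i, Measurable fun x : Fin (n + 1) → ℝ => G i x ^ 2 * w (x i) := fun i =>
      ((hG i).pow_const 2).mul (hw.comp (measurable_pi_apply i))
    refine add_le_add ?_ ?_
    · rw [hL _ (hm 0), lintegral_lintegral_swap (f := fun t y => G 0 (Fin.cons t y) ^ 2 *
        w ((Fin.cons t y : Fin (n + 1) → ℝ) 0)) ((hm 0).comp hmc).aemeasurable]
      refine lintegral_mono fun y => ?_
      refine hP _ (fun t => G 0 (Fin.cons t y)) (hF.comp (hmc.comp measurable_prodMk_right))
        ((hG 0).comp (hmc.comp measurable_prodMk_right)) ?_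
      have := h 0 (Fin.cons 0 y)
      simpa only [Fin.update_cons_zero] using this
    · have : ∀ i : Fin n, ∫⁻ x, G i.succ x ^ 2 * w (x i.succ)
            ∂(Measure.pi fun _ : Fin (n + 1) => μ) =
          ∫⁻ t, ∫⁻ y, G i.succ (Fin.cons t y) ^ 2 * w (y i)
            ∂(Measure.pi fun _ : Fin n => μ) ∂μ := by
        intro i
        rw [hL _ (hm i.succ)]
        simp
      simp_rw [this]
      rw [← lintegral_finsetSum]
      · refine lintegral_mono fun t => ?_
        refine ih (fun y => F (Fin.cons t y)) (fun i y => G i.succ (Fin.cons t y))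
          (hF.comp (hmc.comp measurable_prodMk_left))
          (fun i => (hG _).comp (hmc.comp measurable_prodMk_left)) ?_
        intro i y
        have := h i.succ (Fin.cons t y)
        simpa only [← Fin.cons_update] using this
      · intro i _
        apply Measurable.lintegral_prod_right'
          (f := fun p : ℝ × (Fin n → ℝ) => G i.succ (Fin.cons p.1 p.2) ^ 2 * w (p.2 i))
        exact (((hG _).comp hmc).pow_const 2).mul (hw.comp (by fun_prop))

/-! ### Hardy inequality on the half-line. -/

theorem lintegral_mul_sq_le {α : Type*} [MeasurableSpace α] {μ : Measure α}
    {f g : α → ℝ≥0∞} (hf : Measurable f) (hg : Measurable g) :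
    (∫⁻ x, f x * g x ∂μ) ^ 2 ≤ (∫⁻ x, f x ^ 2 ∂μ) * ∫⁻ x, g x ^ 2 ∂μ := by
  have h := ENNReal.lintegral_mul_le_Lp_mul_Lq μ Real.HolderConjugate.two_two
    hf.aemeasurable hg.aemeasurable
  have h2 := pow_le_pow_left' h 2
  rw [mul_pow] at h2
  simp only [← ENNReal.rpow_natCast, ← ENNReal.rpow_mul] at h2 ⊢
  simpa using h2

theorem lintegral_eq_add_comp_neg {F : ℝ → ℝ≥0∞} :
    ∫⁻ x, F x = (∫⁻ x in Set.Ioi 0, F x) + ∫⁻ x in Set.Ioi 0, F (-x) := by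
  have h := (Measure.measurePreserving_neg (volume : Measure ℝ)).setLIntegral_comp_preimage_emb
    (MeasurableEquiv.neg ℝ).measurableEmbedding F (Set.Iio 0)
  have e : (Neg.neg : ℝ → ℝ) ⁻¹' Set.Iio 0 = Set.Ioi 0 := by ext; simp
  rw [e] at h
  rw [h, ← lintegral_add_compl F (measurableSet_Ioi (a := (0 : ℝ))), Set.compl_Ioi]
  congr 1
  exact (setLIntegral_congr Iio_ae_eq_Iic).symm

/-- The integrand is an exact derivative. The linear term `u / 2` in the exponent keeps the factor
`(u + 1) / 2` away from 0 at the origin. -/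
theorem lintegral_Ioc_exp_quadratic_le {x : ℝ} (hx : 0 ≤ x) :
    ∫⁻ u in Set.Ioc 0 x, ENNReal.ofReal ((u + 1) / 2 * Real.exp (u ^ 2 / 4 + u / 2)) ≤
      ENNReal.ofReal (Real.exp (x ^ 2 / 4 + x / 2)) := by
  have hc : Continuous fun u : ℝ => (u + 1) / 2 * Real.exp (u ^ 2 / 4 + u / 2) := by fun_prop
  have hd : ∀ u : ℝ, HasDerivAt (fun u : ℝ => Real.exp (u ^ 2 / 4 + u / 2))
      ((u + 1) / 2 * Real.exp (u ^ 2 / 4 + u / 2)) u := by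
    intro u
    have h1 : HasDerivAt (fun u : ℝ => u ^ 2 / 4 + u / 2) ((u + 1) / 2) u := by
      refine (((hasDerivAt_pow 2 u).div_const 4).fun_add
        ((hasDerivAt_id' u).div_const 2)).congr_deriv ?_
      norm_num
      ring
    rw [mul_comm]
    exact h1.exp
  have hI := intervalIntegral.integral_eq_sub_of_hasDerivAt (fun u _ => hd u)
    (hc.intervalIntegrable 0 x)
  rw [intervalIntegral.integral_of_le hx] at hI
  rw [← ofReal_integral_eq_lintegral_ofReal ((hc.integrableOn_Icc).mono_set Set.Ioc_subset_Icc_self)]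
  · rw [hI]
    apply ENNReal.ofReal_le_ofReal
    simp
  · filter_upwards [ae_restrict_mem measurableSet_Ioc] with u hu
    have := hu.1
    simp only [Pi.zero_apply]
    positivity

theorem lintegral_Ioi_exp_quadratic_le {t : ℝ} (ht : 0 ≤ t) :
    ∫⁻ x in Set.Ioi t, ENNReal.ofReal (Real.exp (-x ^ 2 / 4 + x / 2)) ≤
      ENNReal.ofReal (4 * Real.exp (-t ^ 2 / 4 + t / 2) / (1 + t)) := by
  -- The derivative `G'` dominates the integrand because `(1 + x) ^ 2 ≤ 2 * (1 + x ^ 2)`.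
  set G : ℝ → ℝ := fun x => -(4 * Real.exp (-x ^ 2 / 4 + x / 2) / (1 + x)) with hG
  set G' : ℝ → ℝ := fun x => 2 * (1 + x ^ 2) / (1 + x) ^ 2 * Real.exp (-x ^ 2 / 4 + x / 2) with hG'
  have hd : ∀ x ∈ Set.Ici t, HasDerivAt G (G' x) x := by
    intro x hx
    have hx0 : 1 + x ≠ 0 := by have : t ≤ x := hx; linarith
    have h1 : HasDerivAt (fun x : ℝ => -x ^ 2 / 4 + x / 2) (-x / 2 + 1 / 2) x := by
      refine (((hasDerivAt_pow 2 x).fun_neg.div_const 4).fun_add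
        ((hasDerivAt_id' x).div_const 2)).congr_deriv ?_
      norm_num
      ring
    have h2 := ((h1.exp.const_mul 4).fun_div ((hasDerivAt_id' x).const_add 1) hx0).fun_neg
    refine h2.congr_deriv ?_
    simp only [hG']
    field_simp
    ring
  have hpos : ∀ x ∈ Set.Ioi t, 0 ≤ G' x := fun x _ => by positivity
  have hlim : Filter.Tendsto G Filter.atTop (nhds 0) := by
    have h3 : Filter.Tendsto (fun x : ℝ => 4 * Real.exp (1 / 4) / (1 + x)) Filter.atTop (nhds 0) :=
      Filter.Tendsto.div_atTop tendsto_const_nhds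
        (Filter.tendsto_atTop_add_const_left _ 1 Filter.tendsto_id)
    rw [← neg_zero]
    refine (squeeze_zero' ?_ ?_ h3).neg
    · filter_upwards [Filter.eventually_ge_atTop 0] with x hx
      positivity
    · filter_upwards [Filter.eventually_ge_atTop 0] with x hx
      gcongr
      nlinarith [sq_nonneg (x - 1)]
  have hint := integrableOn_Ioi_deriv_of_nonneg' hd hpos hlim
  have hval := integral_Ioi_of_hasDerivAt_of_nonneg' hd hpos hlim
  calc ∫⁻ x in Set.Ioi t, ENNReal.ofReal (Real.exp (-x ^ 2 / 4 + x / 2))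
      ≤ ∫⁻ x in Set.Ioi t, ENNReal.ofReal (G' x) := by
        refine setLIntegral_mono' measurableSet_Ioi fun x hx => ENNReal.ofReal_le_ofReal ?_
        have hx0 : 0 < 1 + x := by have : t < x := hx; linarith
        refine le_mul_of_one_le_left (Real.exp_pos _).le ?_
        rw [one_le_div (by positivity)]
        nlinarith [sq_nonneg (x - 1)]
    _ = ENNReal.ofReal (4 * Real.exp (-t ^ 2 / 4 + t / 2) / (1 + t)) := by
        rw [← ofReal_integral_eq_lintegral_ofReal hint, hval]
        · simp [hG]
        · filter_upwards [ae_restrict_mem measurableSet_Ioi] with x hx using hpos x hx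

/-- A weighted Hardy inequality on the half-line for the Gaussian density. -/
theorem hardy_gaussian_half_line {H g : ℝ → ℝ≥0∞} (hg : Measurable g)
    (h : ∀ x, 0 < x → H x ≤ ∫⁻ u in Set.Ioc 0 x, g u) :
    ∫⁻ x in Set.Ioi 0, H x ^ 2 * ENNReal.ofReal (Real.exp (-x ^ 2 / 2)) ≤
      8 * ∫⁻ t in Set.Ioi 0, g t ^ 2 *
        ENNReal.ofReal ((1 / (1 + t)) ^ 2 * Real.exp (-t ^ 2 / 2)) := by
  -- Cauchy–Schwarz is applied to `g = (g / √a) * √a`; the integral of `a` over `(0, x]` is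
  -- explicit.
  set a : ℝ → ℝ := fun u => (u + 1) / 2 * Real.exp (u ^ 2 / 4 + u / 2) with ha
  set b : ℝ → ℝ≥0∞ := fun u => g u ^ 2 * ENNReal.ofReal (a u)⁻¹ with hb
  have ham : Measurable a := by fun_prop
  have hbm : Measurable b := by fun_prop
  have hapos : ∀ u, 0 < u → 0 < a u := fun u hu => by positivity
  have hCS : ∀ x, 0 < x → H x ^ 2 ≤
      (∫⁻ u in Set.Ioc 0 x, b u) * ENNReal.ofReal (Real.exp (x ^ 2 / 4 + x / 2)) := by
    intro x hx
    calc H x ^ 2 ≤ (∫⁻ u in Set.Ioc 0 x, g u) ^ 2 := pow_le_pow_left' (h x hx) 2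
      _ = (∫⁻ u in Set.Ioc 0 x, (g u * ENNReal.ofReal (√(a u))⁻¹) *
            ENNReal.ofReal (√(a u))) ^ 2 := by
          congr 1
          refine setLIntegral_congr_fun measurableSet_Ioc fun u hu => ?_
          have := Real.sqrt_pos.2 (hapos u hu.1)
          rw [mul_assoc, ← ENNReal.ofReal_mul (by positivity), inv_mul_cancel₀ this.ne']
          simp
      _ ≤ (∫⁻ u in Set.Ioc 0 x, (g u * ENNReal.ofReal (√(a u))⁻¹) ^ 2) *
            ∫⁻ u in Set.Ioc 0 x, ENNReal.ofReal (√(a u)) ^ 2 :=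
          lintegral_mul_sq_le (by fun_prop) (by fun_prop)
      _ = (∫⁻ u in Set.Ioc 0 x, b u) * ∫⁻ u in Set.Ioc 0 x, ENNReal.ofReal (a u) := by
          congr 1
          · refine setLIntegral_congr_fun measurableSet_Ioc fun u hu => ?_
            simp only [hb]
            rw [mul_pow, ← ENNReal.ofReal_pow (by positivity), inv_pow,
              Real.sq_sqrt (hapos u hu.1).le]
          · refine setLIntegral_congr_fun measurableSet_Ioc fun u hu => ?_
            rw [← ENNReal.ofReal_pow (by positivity), Real.sq_sqrt (hapos u hu.1).le]
      _ ≤ _ := by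
          gcongr
          exact lintegral_Ioc_exp_quadratic_le hx.le
  have hexp : ∀ x : ℝ, ENNReal.ofReal (Real.exp (x ^ 2 / 4 + x / 2)) *
      ENNReal.ofReal (Real.exp (-x ^ 2 / 2)) = ENNReal.ofReal (Real.exp (-x ^ 2 / 4 + x / 2)) := by
    intro x
    rw [← ENNReal.ofReal_mul (Real.exp_pos _).le, ← Real.exp_add]
    congr 2
    ring
  set K : ℝ → ℝ → ℝ≥0∞ := fun x u => Set.indicator {p : ℝ × ℝ | 0 < p.2 ∧ p.2 ≤ p.1}
    (fun p => b p.2 * ENNReal.ofReal (Real.exp (-p.1 ^ 2 / 4 + p.1 / 2))) (x, u) with hK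
  have hKm : Measurable (Function.uncurry K) := by
    have : Measurable fun p : ℝ × ℝ =>
        b p.2 * ENNReal.ofReal (Real.exp (-p.1 ^ 2 / 4 + p.1 / 2)) := by fun_prop
    exact this.indicator ((measurableSet_lt measurable_const measurable_snd).inter
      (measurableSet_le measurable_snd measurable_fst))
  -- One factor `1 / (1 + u)` comes from `1 / a`, the other from the tail; the constant is `8 = 2 *
  -- 4`.
  have h8 : ∀ u : ℝ, 0 < u → ENNReal.ofReal (a u)⁻¹ *
      ENNReal.ofReal (4 * Real.exp (-u ^ 2 / 4 + u / 2) / (1 + u)) =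
      8 * ENNReal.ofReal ((1 / (1 + u)) ^ 2 * Real.exp (-u ^ 2 / 2)) := by
    intro u hu
    have e8 : (8 : ℝ≥0∞) = ENNReal.ofReal 8 := by simp
    have ha0 : 0 ≤ (a u)⁻¹ := (inv_pos.2 (hapos u hu)).le
    rw [e8, ← ENNReal.ofReal_mul (p := 8) (by norm_num), ← ENNReal.ofReal_mul ha0]
    congr 1
    have e1 : Real.exp (-u ^ 2 / 4 + u / 2) =
        Real.exp (-u ^ 2 / 2) * Real.exp (u ^ 2 / 4 + u / 2) := by
      rw [← Real.exp_add]; congr 1; ring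
    rw [e1]
    simp only [ha]
    have := Real.exp_pos (u ^ 2 / 4 + u / 2)
    field_simp
    ring
  calc ∫⁻ x in Set.Ioi 0, H x ^ 2 * ENNReal.ofReal (Real.exp (-x ^ 2 / 2))
      ≤ ∫⁻ x in Set.Ioi 0, ∫⁻ u, K x u := by
        refine setLIntegral_mono' measurableSet_Ioi fun x hx => ?_
        calc H x ^ 2 * ENNReal.ofReal (Real.exp (-x ^ 2 / 2))
            ≤ (∫⁻ u in Set.Ioc 0 x, b u) * ENNReal.ofReal (Real.exp (x ^ 2 / 4 + x / 2)) *
              ENNReal.ofReal (Real.exp (-x ^ 2 / 2)) := by gcongr; exact hCS x hx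
          _ = ∫⁻ u in Set.Ioc 0 x, b u * ENNReal.ofReal (Real.exp (-x ^ 2 / 4 + x / 2)) := by
              rw [mul_assoc, hexp, lintegral_mul_const _ hbm]
          _ = ∫⁻ u, K x u := by
              rw [← lintegral_indicator measurableSet_Ioc]
              rfl
    _ ≤ ∫⁻ x, ∫⁻ u, K x u := setLIntegral_le_lintegral _ _
    _ = ∫⁻ u, ∫⁻ x, K x u := lintegral_lintegral_swap hKm.aemeasurable
    _ ≤ ∫⁻ u in Set.Ioi 0, 8 * (g u ^ 2 *
          ENNReal.ofReal ((1 / (1 + u)) ^ 2 * Real.exp (-u ^ 2 / 2))) := by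
        rw [← lintegral_indicator measurableSet_Ioi]
        refine lintegral_mono fun u => ?_
        by_cases hu : 0 < u
        · have e1 : ∀ x, K x u = Set.indicator (Set.Ici u)
              (fun x => b u * ENNReal.ofReal (Real.exp (-x ^ 2 / 4 + x / 2))) x := by
            intro x
            simp only [hK, Set.indicator_apply, Set.mem_ofPred_eq, Set.mem_Ici, hu, true_and]
          simp_rw [e1]
          rw [lintegral_indicator measurableSet_Ici, lintegral_const_mul _ (by fun_prop),
            setLIntegral_congr Ioi_ae_eq_Ici.symm, Set.indicator_of_mem (Set.mem_Ioi.2 hu)]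
          calc b u * _ ≤ b u * ENNReal.ofReal (4 * Real.exp (-u ^ 2 / 4 + u / 2) / (1 + u)) := by
                gcongr
                exact lintegral_Ioi_exp_quadratic_le hu.le
            _ = _ := by
                simp only [hb]
                rw [mul_assoc, h8 u hu]
                ring
        · have e1 : ∀ x, K x u = 0 := by
            intro x
            simp [hK, Set.indicator_apply, hu]
          simp [e1]
    _ = _ := by
        rw [lintegral_const_mul _ (by fun_prop)]

/-! ### Poincaré inequality for the Gaussian measure. -/

theorem lintegral_gaussianReal_zero_one {F : ℝ → ℝ≥0∞} (hF : Measurable F) :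
    ∫⁻ x, F x ∂(gaussianReal 0 1) =
      ENNReal.ofReal (√(2 * Real.pi))⁻¹ *
        ∫⁻ x, F x * ENNReal.ofReal (Real.exp (-x ^ 2 / 2)) := by
  rw [gaussianReal_of_var_ne_zero 0 one_ne_zero,
    lintegral_withDensity_eq_lintegral_mul _ (measurable_gaussianPDF 0 1) hF,
    ← lintegral_const_mul _ (by fun_prop)]
  refine lintegral_congr fun x => ?_
  simp only [Pi.mul_apply, gaussianPDF, gaussianPDFReal, NNReal.coe_one, mul_one, sub_zero]
  rw [ENNReal.ofReal_mul (by positivity)]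
  ring

/-- The one-dimensional weighted Poincaré inequality for the Gaussian measure. -/
theorem doubleVar_gaussianReal_le {f : ℝ → ℝ} {g : ℝ → ℝ≥0∞} (hf : Measurable f)
    (hg : Measurable g) (h : IsUpperGradient f g) :
    doubleVar (gaussianReal 0 1) f ≤
      ∫⁻ t, g t ^ 2 * (32 * ENNReal.ofReal ((1 / (1 + |t|)) ^ 2)) ∂(gaussianReal 0 1) := by
  -- The factor 4 here times the Hardy constant 8 gives 32.
  refine (doubleVar_le_lintegral_sub_const hf (f 0)).trans ?_
  have hpos := hardy_gaussian_half_line (H := fun x => ‖f x - f 0‖ₑ) hg fun x hx => h 0 x hx.le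
  have hneg := hardy_gaussian_half_line (H := fun x => ‖f (-x) - f 0‖ₑ) (g := fun u => g (-u))
    (by fun_prop) fun x hx => by
      have h1 := h (-x) 0 (by linarith)
      rw [← enorm_neg, neg_sub] at h1
      refine h1.trans (le_of_eq ?_)
      have h2 := (Measure.measurePreserving_neg
        (volume : Measure ℝ)).setLIntegral_comp_preimage_emb
        (MeasurableEquiv.neg ℝ).measurableEmbedding g (Set.Ioc (-x) 0)
      rw [← h2]
      have e : (Neg.neg : ℝ → ℝ) ⁻¹' Set.Ioc (-x) 0 = Set.Ico 0 x := by
        ext u; simp [and_comm]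
      rw [e]
      exact setLIntegral_congr Ico_ae_eq_Ioc
  have e1 : ∀ t, g t ^ 2 * (32 * ENNReal.ofReal ((1 / (1 + |t|)) ^ 2)) =
      32 * (g t ^ 2 * ENNReal.ofReal ((1 / (1 + |t|)) ^ 2)) := fun t => by ring
  simp_rw [e1]
  rw [lintegral_const_mul _ (by fun_prop), lintegral_gaussianReal_zero_one (by fun_prop),
    lintegral_gaussianReal_zero_one (by fun_prop), lintegral_eq_add_comp_neg,
    lintegral_eq_add_comp_neg (F := fun x => g x ^ 2 * ENNReal.ofReal ((1 / (1 + |x|)) ^ 2) *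
      ENNReal.ofReal (Real.exp (-x ^ 2 / 2)))]
  have e2 : ∀ k : ℝ → ℝ≥0∞, ∫⁻ t in Set.Ioi 0, k t ^ 2 * ENNReal.ofReal ((1 / (1 + |t|)) ^ 2) *
      ENNReal.ofReal (Real.exp (-t ^ 2 / 2)) = ∫⁻ t in Set.Ioi 0, k t ^ 2 *
        ENNReal.ofReal ((1 / (1 + t)) ^ 2 * Real.exp (-t ^ 2 / 2)) := by
    intro k
    refine setLIntegral_congr_fun measurableSet_Ioi fun t ht => ?_
    rw [abs_of_pos ht, mul_assoc, ENNReal.ofReal_mul (by positivity)]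
  have e3 := e2 fun t => g (-t)
  simp only [abs_neg, neg_sq]
  rw [e2, e3]
  calc _ ≤ 4 * (ENNReal.ofReal (√(2 * Real.pi))⁻¹ * (8 * _ + 8 * _)) := by
        gcongr
    _ = _ := by ring

theorem isUpperGradient_of_hasDerivAt {f f' : ℝ → ℝ} (hd : ∀ u, HasDerivAt f (f' u) u)
    (hc : Continuous f') : IsUpperGradient f fun u => ‖f' u‖ₑ := by
  intro s t hst
  rw [← intervalIntegral.integral_eq_sub_of_hasDerivAt (fun u _ => hd u)
    (hc.intervalIntegrable s t), intervalIntegral.integral_of_le hst]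
  exact enorm_integral_le_lintegral_enorm _

instance (n : ℕ) : IsProbabilityMeasure (stdGaussianPi n) := by
  unfold stdGaussianPi; infer_instance

/-- The weighted Poincaré inequality for functions with upper gradients along coordinate lines. -/
theorem evariance_stdGaussianPi_le {n : ℕ} {F : (Fin n → ℝ) → ℝ}
    {G : Fin n → (Fin n → ℝ) → ℝ≥0∞} (hF : Measurable F) (hG : ∀ i, Measurable (G i))
    (h : ∀ i x, IsUpperGradient (fun u => F (Function.update x i u))
      (fun u => G i (Function.update x i u))) :
    evariance F (stdGaussianPi n) ≤ 32 * ∑ i, ∫⁻ x,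
      G i x ^ 2 * ENNReal.ofReal ((1 / (1 + |x i|)) ^ 2) ∂(stdGaussianPi n) := by
  refine (evariance_le_doubleVar hF).trans ?_
  refine (doubleVar_pi_le (w := fun t => 32 * ENNReal.ofReal ((1 / (1 + |t|)) ^ 2)) (by fun_prop)
    (fun f g hf hg hfg => doubleVar_gaussianReal_le hf hg hfg) n F G hF hG h).trans (le_of_eq ?_)
  rw [Finset.mul_sum]
  refine Finset.sum_congr rfl fun i _ => ?_
  have := hG i
  rw [← lintegral_const_mul _ (by fun_prop)]
  refine lintegral_congr fun x => ?_
  ring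

theorem evariance_stdGaussianPi_le_of_contDiff {n : ℕ} {f : (Fin n → ℝ) → ℝ}
    (hf : ContDiff ℝ 1 f) :
    evariance f (stdGaussianPi n) ≤ 32 * ∑ i : Fin n, ∫⁻ x,
      ENNReal.ofReal ((partialDeriv f i x) ^ 2 * (1 / (1 + |x i|)) ^ 2) ∂(stdGaussianPi n) := by
  have hc : ∀ i, Continuous (partialDeriv f i) := fun i =>
    (hf.continuous_fderiv one_ne_zero).clm_apply continuous_const
  refine (evariance_stdGaussianPi_le (G := fun i x => ‖partialDeriv f i x‖ₑ)
    hf.continuous.measurable (fun i => (hc i).measurable.enorm) ?_).trans (le_of_eq ?_)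
  · intro i x
    refine isUpperGradient_of_hasDerivAt
      (f' := fun u => partialDeriv f i (Function.update x i u)) (fun u => ?_) ?_
    · exact ((hf.differentiable one_ne_zero _).hasFDerivAt).comp_hasDerivAt u
        (hasDerivAt_update x i u)
    · exact (hc i).comp (continuous_const.update i continuous_id)
  · congr 1
    refine Finset.sum_congr rfl fun i _ => lintegral_congr fun x => ?_
    rw [← enorm_pow, Real.enorm_of_nonneg (sq_nonneg _), ← ENNReal.ofReal_mul (sq_nonneg _)]

/-! ### The maximum of the coordinates. -/

theorem measurable_iSup_coord (n : ℕ) : Measurable fun x : Fin n → ℝ => ⨆ i, x i :=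
  Measurable.iSup fun i => measurable_pi_apply i

/-- With `v` the maximum at `s`, the maximum grows by at most the positive part of `t - v`, and
coordinate `i` is the strict maximum throughout `(v, t]`. -/
theorem isUpperGradient_iSup_update {n : ℕ} (x : Fin n → ℝ) (i : Fin n) :
    IsUpperGradient (fun u => ⨆ j, Function.update x i u j)
      (fun u => Set.indicator {y : Fin n → ℝ | ∀ j, j ≠ i → y j < y i} 1
        (Function.update x i u)) := by
  intro s t hst
  have : Nonempty (Fin n) := ⟨i⟩
  have hle : ∀ (y : Fin n → ℝ) j, y j ≤ ⨆ k, y k := fun y j =>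
    le_ciSup (Set.finite_range y).bddAbove j
  set v := ⨆ j, Function.update x i s j with hv
  have hsv : s ≤ v := by simpa using hle (Function.update x i s) i
  have hjv : ∀ j, j ≠ i → x j ≤ v := fun j hj => by
    simpa [hj] using hle (Function.update x i s) j
  have h1 : v ≤ ⨆ j, Function.update x i t j :=
    ciSup_mono (Set.finite_range _).bddAbove fun j => Function.update_mono hst j
  have h2 : (⨆ j, Function.update x i t j) ≤ max t v := by
    refine ciSup_le fun j => ?_
    by_cases hj : j = i
    · subst hj; simp
    · simp [hj, hjv j hj]
  calc ‖(⨆ j, Function.update x i t j) - v‖ₑ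
      = ENNReal.ofReal ((⨆ j, Function.update x i t j) - v) :=
        Real.enorm_of_nonneg (sub_nonneg.2 h1)
    _ ≤ ENNReal.ofReal (t - v) := by
        rcases le_total t v with htv | htv
        · rw [max_eq_right htv] at h2
          rw [ENNReal.ofReal_of_nonpos (by linarith)]
          exact zero_le
        · rw [max_eq_left htv] at h2
          exact ENNReal.ofReal_le_ofReal (by linarith)
    _ = ∫⁻ u in Set.Ioc v t, 1 := by simp
    _ ≤ ∫⁻ u in Set.Ioc v t, Set.indicator {y : Fin n → ℝ | ∀ j, j ≠ i → y j < y i} 1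
        (Function.update x i u) := by
        refine setLIntegral_mono' measurableSet_Ioc fun u hu => ?_
        rw [Set.indicator_of_mem]
        · simp
        · intro j hj
          simpa [hj] using (hjv j hj).trans_lt hu.1
    _ ≤ _ := lintegral_mono_set (Set.Ioc_subset_Ioc_left hsv)

/-- At most one coordinate is a strict maximum, so at most one term survives, and `1 + t ^ 2 ≤ (1 +
|t|) ^ 2`. -/
theorem sum_indicator_strict_max_le {n : ℕ} (x : Fin n → ℝ) :
    ∑ i, (Set.indicator {y : Fin n → ℝ | ∀ j, j ≠ i → y j < y i} 1 x) ^ 2 *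
      ENNReal.ofReal ((1 / (1 + |x i|)) ^ 2) ≤ ENNReal.ofReal (1 / (1 + (⨆ i, x i) ^ 2)) := by
  by_cases h : ∃ i, ∀ j, j ≠ i → x j < x i
  · obtain ⟨i, hi⟩ := h
    have : Nonempty (Fin n) := ⟨i⟩
    have hmax : ⨆ j, x j = x i := by
      refine le_antisymm (ciSup_le fun j => ?_) (le_ciSup (Set.finite_range x).bddAbove i)
      by_cases hj : j = i
      · rw [hj]
      · exact (hi j hj).le
    rw [Finset.sum_eq_single i, hmax]
    · rw [Set.indicator_of_mem (show x ∈ {y : Fin n → ℝ | ∀ j, j ≠ i → y j < y i} from hi)]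
      simp only [Pi.one_apply, one_pow, one_mul]
      apply ENNReal.ofReal_le_ofReal
      rw [div_pow, one_pow]
      gcongr
      nlinarith [abs_nonneg (x i), sq_abs (x i)]
    · intro j _ hj
      rw [Set.indicator_of_notMem]
      · simp
      · intro hx
        exact lt_asymm (hi j hj) (hx i hj.symm)
    · simp
  · push Not at h
    rw [Finset.sum_eq_zero]
    · exact zero_le
    · intro i _
      rw [Set.indicator_of_notMem]
      · simp
      · intro hx
        obtain ⟨j, hj, hle⟩ := h i
        exact absurd (hx j hj) (not_lt.2 hle)

theorem integrable_one_div_one_add_sq {α : Type*} [MeasurableSpace α] {μ : Measure α}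
    [IsFiniteMeasure μ] {f : α → ℝ} (hf : Measurable f) :
    Integrable (fun x => 1 / (1 + f x ^ 2)) μ := by
  refine (integrable_const (1 : ℝ)).mono'
    (Measurable.aestronglyMeasurable (by fun_prop)) (ae_of_all _ fun x => ?_)
  rw [Real.norm_of_nonneg (by positivity), div_le_one (by positivity)]
  nlinarith [sq_nonneg (f x)]

theorem evariance_iSup_le (n : ℕ) :
    evariance (fun x : Fin n → ℝ => ⨆ i, x i) (stdGaussianPi n) ≤
      ENNReal.ofReal (32 * ∫ x, 1 / (1 + (⨆ i, x i) ^ 2) ∂(stdGaussianPi n)) := by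
  have hms : ∀ i : Fin n, MeasurableSet {y : Fin n → ℝ | ∀ j, j ≠ i → y j < y i} := by
    intro i
    simp only [Set.ofPred_forall]
    exact MeasurableSet.iInter fun j => MeasurableSet.iInter fun _ =>
      measurableSet_lt (measurable_pi_apply j) (measurable_pi_apply i)
  have hm : ∀ i : Fin n, Measurable
      (Set.indicator {y : Fin n → ℝ | ∀ j, j ≠ i → y j < y i} (1 : (Fin n → ℝ) → ℝ≥0∞)) :=
    fun i => measurable_one.indicator (hms i)
  refine (evariance_stdGaussianPi_le (measurable_iSup_coord n) hm
    fun i x => isUpperGradient_iSup_update x i).trans ?_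
  rw [← lintegral_finsetSum _ fun i _ => by have := hm i; fun_prop,
    ENNReal.ofReal_mul (by norm_num), ENNReal.ofReal_ofNat,
    ofReal_integral_eq_lintegral_ofReal
      (integrable_one_div_one_add_sq (measurable_iSup_coord n))
      (ae_of_all _ fun x => by simp only [Pi.zero_apply]; positivity)]
  gcongr with x
  exact sum_indicator_strict_max_le x

/-! ### Logarithmic size of the maximum. -/

/-- Integrate the density over `[a, a + 1]` only, where `x ^ 2 / 2 ≤ a ^ 2 + 1`. -/
theorem gaussianReal_Ici_ge (a : ℝ) :
    Real.exp (-(a ^ 2 + 1)) / 3 ≤ (gaussianReal 0 1).real (Set.Ici a) := by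
  have hpi : (1 : ℝ) / 3 ≤ (√(2 * Real.pi))⁻¹ := by
    rw [one_div]
    refine inv_anti₀ (by positivity) ?_
    rw [Real.sqrt_le_left (by norm_num)]
    nlinarith [Real.pi_lt_four]
  have h : ENNReal.ofReal (Real.exp (-(a ^ 2 + 1)) / 3) ≤ gaussianReal 0 1 (Set.Ici a) := by
    calc ENNReal.ofReal (Real.exp (-(a ^ 2 + 1)) / 3)
        = ∫⁻ x in Set.Icc a (a + 1), ENNReal.ofReal (Real.exp (-(a ^ 2 + 1)) / 3) := by simp
      _ ≤ ∫⁻ x in Set.Icc a (a + 1), gaussianPDF 0 1 x := by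
          refine setLIntegral_mono' measurableSet_Icc fun x hx => ENNReal.ofReal_le_ofReal ?_
          simp only [gaussianPDFReal, NNReal.coe_one, mul_one, sub_zero]
          rw [div_eq_mul_one_div, mul_comm]
          gcongr
          nlinarith [hx.1, hx.2, sq_nonneg (a - 1)]
      _ = gaussianReal 0 1 (Set.Icc a (a + 1)) := (gaussianReal_apply 0 one_ne_zero _).symm
      _ ≤ _ := measure_mono Set.Icc_subset_Ici_self
  rw [measureReal_def]
  exact (ENNReal.ofReal_le_iff_le_toReal (measure_ne_top _ _)).1 h

/-- By independence the probability is at most `(1 - p) ^ n ≤ exp (-n * p) ≤ 1 / (n * p)`. -/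
theorem stdGaussianPi_iSup_lt_le {n : ℕ} (hn : 1 ≤ n) (a : ℝ) :
    (stdGaussianPi n).real {x | ⨆ i, x i < a} ≤ 3 * Real.exp (a ^ 2 + 1) / n := by
  set p := Real.exp (-(a ^ 2 + 1)) / 3 with hp
  have hp0 : 0 < p := by positivity
  have hn0 : (0 : ℝ) < n := by exact_mod_cast hn
  have hq : (gaussianReal 0 1).real (Set.Iio a) ≤ 1 - p := by
    have := gaussianReal_Ici_ge a
    rw [← Set.compl_Ici, probReal_compl_eq_one_sub measurableSet_Ici]
    linarith
  calc (stdGaussianPi n).real {x | ⨆ i, x i < a}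
      ≤ (stdGaussianPi n).real (Set.univ.pi fun _ => Set.Iio a) := by
        refine measureReal_mono fun x hx i _ => ?_
        exact (le_ciSup (Set.finite_range x).bddAbove i).trans_lt hx
    _ = (gaussianReal 0 1).real (Set.Iio a) ^ n := by
        simp [measureReal_def, stdGaussianPi, Measure.pi_pi]
    _ ≤ Real.exp (-p) ^ n := by
        gcongr
        linarith [Real.add_one_le_exp (-p)]
    _ = (Real.exp (n * p))⁻¹ := by
        rw [← Real.exp_nat_mul, ← Real.exp_neg]; ring_nf
    _ ≤ (n * p)⁻¹ := by
        refine inv_anti₀ (by positivity) ?_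
        linarith [Real.add_one_le_exp (n * p)]
    _ = 3 * Real.exp (a ^ 2 + 1) / n := by
        rw [hp, Real.exp_neg]
        field_simp

theorem integral_one_div_one_add_iSup_sq_le {n : ℕ} (hn : 1 ≤ n) :
    ∫ x, 1 / (1 + (⨆ i, x i) ^ 2) ∂(stdGaussianPi n) ≤ 20 / (1 + Real.log n) := by
  have hn0 : (0 : ℝ) < n := by exact_mod_cast hn
  set l := Real.log n with hl
  have hl0 : 0 ≤ l := Real.log_natCast_nonneg n
  -- This level makes `exp (a ^ 2) = √n`, so the probability of falling below it is of order `1 /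
  -- √n`.
  set a := √(l / 2) with ha
  have ha2 : a ^ 2 = l / 2 := Real.sq_sqrt (by positivity)
  have hS : MeasurableSet {x : Fin n → ℝ | ⨆ i, x i < a} :=
    measurableSet_lt (measurable_iSup_coord n) measurable_const
  have hI : Integrable (Set.indicator {x : Fin n → ℝ | ⨆ i, x i < a} (1 : (Fin n → ℝ) → ℝ))
      (stdGaussianPi n) := (integrable_const (1 : ℝ)).indicator hS
  have hnl : (n : ℝ) = Real.exp (l / 2) * Real.exp (l / 2) := by
    rw [← Real.exp_add, add_halves, hl, Real.exp_log hn0]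
  calc ∫ x, 1 / (1 + (⨆ i, x i) ^ 2) ∂(stdGaussianPi n)
      ≤ ∫ x, (1 / (1 + a ^ 2) + Set.indicator {x : Fin n → ℝ | ⨆ i, x i < a} 1 x)
          ∂(stdGaussianPi n) := by
        refine integral_mono (integrable_one_div_one_add_sq (measurable_iSup_coord n))
          ((integrable_const _).add hI) fun x => ?_
        by_cases hx : ⨆ i, x i < a
        · rw [Set.indicator_of_mem (show x ∈ {x : Fin n → ℝ | ⨆ i, x i < a} from hx)]
          have h1 : 1 / (1 + (⨆ i, x i) ^ 2) ≤ 1 := by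
            rw [div_le_one (by positivity)]
            nlinarith [sq_nonneg (⨆ i, x i)]
          have h2 : 0 ≤ 1 / (1 + a ^ 2) := by positivity
          simp only [Pi.one_apply]
          linarith
        · rw [Set.indicator_of_notMem (show x ∉ {x : Fin n → ℝ | ⨆ i, x i < a} from hx), add_zero]
          have : a ≤ ⨆ i, x i := not_lt.1 hx
          have : 0 ≤ a := Real.sqrt_nonneg _
          simp only
          gcongr
    _ = 1 / (1 + a ^ 2) + (stdGaussianPi n).real {x | ⨆ i, x i < a} := by
        rw [integral_add (integrable_const _) hI, integral_indicator_one hS]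
        simp
    _ ≤ 1 / (1 + a ^ 2) + 3 * Real.exp (a ^ 2 + 1) / n := by
        gcongr
        exact stdGaussianPi_iSup_lt_le hn a
    -- `18 = 3 * 3 * 2`, from the prefactor, `exp 1 ≤ 3` and `1 + l ≤ 2 * exp (l / 2)`.
    _ ≤ 2 / (1 + l) + 18 / (1 + l) := by
        have h3 : Real.exp 1 ≤ 3 := Real.exp_one_lt_three.le
        have h4 := Real.add_one_le_exp (l / 2)
        have h5 := Real.exp_pos (l / 2)
        rw [ha2]
        refine add_le_add ?_ ?_
        · rw [div_le_div_iff₀ (by positivity) (by positivity)]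
          linarith
        · rw [Real.exp_add, hnl, div_le_div_iff₀ (by positivity) (by positivity)]
          have h6 : Real.exp 1 * (1 + l) ≤ 3 * (2 * Real.exp (l / 2)) :=
            mul_le_mul h3 (by linarith) (by linarith) (by norm_num)
          nlinarith
    _ = 20 / (1 + l) := by rw [← add_div]; norm_num

theorem mainTheorem3 :
    ∃ C : ℝ, 0 < C ∧
      -- the weighted Poincaré inequality, with values in `[0, ∞]`
      (∀ n : ℕ, 1 ≤ n → ∀ f : (Fin n → ℝ) → ℝ, ContDiff ℝ 1 f →
        evariance f (stdGaussianPi n) ≤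
          ENNReal.ofReal C * ∑ i : Fin n, ∫⁻ x,
            ENNReal.ofReal ((partialDeriv f i x) ^ 2 * (1 / (1 + |x i|)) ^ 2)
              ∂(stdGaussianPi n)) ∧
      -- the variance of the maximum of i.i.d. standard Gaussian variables
      ∃ C' : ℝ, 0 < C' ∧
        ∀ n : ℕ, 1 ≤ n → ∀ (Ω : Type*) (_ : MeasurableSpace Ω) (P : Measure Ω)
          (_ : IsProbabilityMeasure P) (X : Fin n → Ω → ℝ),
          (∀ i, HasLaw (X i) (gaussianReal 0 1) P) → iIndepFun X P →
          MemLp (maxOf X) 2 P ∧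
          variance (maxOf X) P ≤ C * ∫ ω, 1 / (1 + (maxOf X ω) ^ 2) ∂P ∧
          C * ∫ ω, 1 / (1 + (maxOf X ω) ^ 2) ∂P ≤ C' / (1 + Real.log n) := by
  refine ⟨32, by norm_num, fun n _ f hf => ?_, 32 * 20, by norm_num, ?_⟩
  · rw [ENNReal.ofReal_ofNat]
    exact evariance_stdGaussianPi_le_of_contDiff hf
  · intro n hn Ω _ P _ X hX hind
    have hlaw : HasLaw (fun ω i => X i ω) (stdGaussianPi n) P := hind.hasLaw_pi hX
    have hM := measurable_iSup_coord n
    have hint : ∫ ω, 1 / (1 + (maxOf X ω) ^ 2) ∂P =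
        ∫ x, 1 / (1 + (⨆ i, x i) ^ 2) ∂(stdGaussianPi n) :=
      hlaw.integral_comp (f := fun x : Fin n → ℝ => 1 / (1 + (⨆ i, x i) ^ 2))
        (Measurable.aestronglyMeasurable (by fun_prop))
    have hvar : variance (maxOf X) P =
        variance (fun x : Fin n → ℝ => ⨆ i, x i) (stdGaussianPi n) := by
      rw [← hlaw.map_eq, variance_map (hlaw.map_eq ▸ hM.aemeasurable) hlaw.aemeasurable]
      rfl
    have hev := evariance_iSup_le n
    -- Square integrability comes from the variance bound itself, whose right-hand side is finite.
    have hL2 : MemLp (fun x : Fin n → ℝ => ⨆ i, x i) 2 (stdGaussianPi n) :=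
      (evariance_lt_top_iff_memLp hM.aestronglyMeasurable).1 (hev.trans_lt ENNReal.ofReal_lt_top)
    refine ⟨?_, ?_, ?_⟩
    · rw [← hlaw.map_eq] at hL2
      exact hL2.comp_of_map hlaw.aemeasurable
    · rw [hvar, hint]
      refine ENNReal.toReal_le_of_le_ofReal ?_ hev
      exact mul_nonneg (by norm_num)
        (integral_nonneg fun x => by simp only [Pi.zero_apply]; positivity)
    · rw [hint, mul_div_assoc]
      gcongr
      exact integral_one_div_one_add_iSup_sq_le hn
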